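/- Conventions. Let $n\in\mathbb N\cup\{\omega\}$. An $n$-globular set $X$ consists of sets $X_i$ ($i\in\mathbb N$, $i\le n$) and maps $\partial^-_i,\partial^+_i\colon X_{i+1}\to X_i$ ($i+1\le n$) with $\partial^\epsilon_i\partial^-_{i+1}=\partial^\epsilon_i\partial^+_{i+1}$ for $\epsilon\in\{-,+\}$; morphisms are families of maps commuting with all $\partial^-_i,\partial^+_i$. They form the category $\mathbf{Glob}_n$. For $k\le n$, the truncation $(-)_{\le k}\colon\mathbf{Glob}_n\to\mathbf{Glob}_k$ forgets the cells of dimension $>k$; its left adjoint, the inclusion $(-)_{\uparrow n}$, adds no cells; the unit of this adjunction is the identity and $\mathrm i^k\colon ((-)_{\le k})_{\uparrow n}\Rightarrow \mathrm{id}$ is its counit. Let $(T,\eta,\mu)$ be a finitary monad on $\mathbf{Glob}_n$ (i.e. $T$ preserves filtered colimits). For $k\le n$ let $T^k=(T((-)_{\uparrow n}))_{\le k}$ be the monad on $\mathbf{Glob}_k$ induced by $T$ and the adjunction $(-)_{\uparrow n}\dashv(-)_{\le k}$ (so $T^n=T$), let $\mathrm{Alg}_k$ be the category of $T^k$-algebras,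 called $k$-categories, and $U_k\colon\mathrm{Alg}_k\to\mathbf{Glob}_k$ the forgetful functor. For $k\le l\le n$, the truncation $(-)_{\le k}\colon\mathrm{Alg}_l\to\mathrm{Alg}_k$ sends $(X,h)$ to $X_{\le k}$ with structure map $T^k(X_{\le k})\to(T^lX)_{\le k}\xrightarrow{h_{\le k}}X_{\le k}$, the first map being the canonical one. The monad $T$ is truncable if, for every $k<n$, the natural transformation $(T\,\mathrm i^k)_{\le k}\colon T^k((-)_{\le k})\Rightarrow (T(-))_{\le k}$ is an identity. For $k\in\mathbb N$ with $k+1\le n$, the category $\mathrm{Alg}_k^+$ of $k$-cellular extensions is the pullback of $U_k\colon\mathrm{Alg}_k\to\mathbf{Glob}_k$ and $(-)_{\le k}\colon\mathbf{Glob}_{k+1}\to\mathbf{Glob}_k$: its objects are the pairs $(C,X)$ of a $k$-category $C$ and a $(k+1)$-globular set $X$ with $U_kC=X_{\le k}$. Let $V_k\colon\mathrm{Alg}_{k+1}\to\mathrm{Alg}_k^+$ be the functor $D\mapsto(D_{\le k},U_{k+1}D)$. Statement. Suppose that the finitary monad $T$ is truncable, and let $k\in\mathbb N$ with $k+1\le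 n$. Then $V_k$ has a left adjoint and, for any left adjoint $(C,X)\mapsto C[X]$ of $V_k$ (the free extension functor), there is an isomorphism of $k$-categories $$C\;\cong\;C[X]_{\le k}$$ natural in the $k$-cellular extension $(C,X)$; namely, the $\mathrm{Alg}_k$-component $C\to C[X]_{\le k}$ of the unit $(C,X)\to V_k(C[X])$ is an isomorphism. In particular, freely adding $(k+1)$-generators does not change the underlying $k$-category. -/

import Mathlib

open CategoryTheory CategoryTheory.Limits

universe u

section Lift

/- Auxiliary computations for the functor between categories of algebras below. -/

universe v₁ v₂ v₃ u₁ u₂ u₃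

variable {A : Type u₁} [Category.{v₁} A] {B : Type u₂} [Category.{v₂} B]
  {C : Type u₃} [Category.{v₃} C] (T : Monad A) {L : B ⥤ A} {R : A ⥤ B} (adj : L ⊣ R)
  (S : B ⥤ C) {L' : C ⥤ A} (adj' : L' ⊣ R ⋙ S) (j : S ⋙ L' ⟶ L)

theorem algLift_unit (hj : ∀ X, adj'.unit.app (S.obj X) ≫ S.map (R.map (j.app X)) =
      S.map (adj.unit.app X)) (X : B) (a : R.obj (T.obj (L.obj X)) ⟶ X)
    (ha : (adj.unit.app X ≫ R.map (T.η.app (L.obj X))) ≫ a = 𝟙 X) :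
    (adj'.unit.app (S.obj X) ≫ S.map (R.map (T.η.app (L'.obj (S.obj X))))) ≫
      S.map (R.map (T.map (j.app X)) ≫ a) = 𝟙 (S.obj X) := by
  have h1 : S.map (R.map (T.η.app (L'.obj (S.obj X)))) ≫ S.map (R.map (T.map (j.app X))) =
      S.map (R.map (j.app X)) ≫ S.map (R.map (T.η.app (L.obj X))) := by
    rw [← S.map_comp, ← S.map_comp, ← R.map_comp, ← R.map_comp]
    exact congrArg (fun f => S.map (R.map f)) (T.η.naturality (j.app X)).symm
  have h2 := congrArg S.map ha
  simp only [S.map_comp, Category.assoc] at h2 ⊢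
  rw [reassoc_of% h1, reassoc_of% (hj X), h2]
  exact S.map_id X

theorem algLift_assoc (hj : ∀ Y, j.app (R.obj Y) ≫ adj.counit.app Y = adj'.counit.app Y)
    (X : B) (a : R.obj (T.obj (L.obj X)) ⟶ X)
    (ha : (R.map (T.map (adj.counit.app (T.obj (L.obj X)))) ≫ R.map (T.μ.app (L.obj X))) ≫ a =
      R.map (T.map (L.map a)) ≫ a) :
    (S.map (R.map (T.map (adj'.counit.app (T.obj (L'.obj (S.obj X)))))) ≫
        S.map (R.map (T.μ.app (L'.obj (S.obj X))))) ≫ S.map (R.map (T.map (j.app X)) ≫ a) =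
      S.map (R.map (T.map (L'.map (S.map (R.map (T.map (j.app X)) ≫ a))))) ≫
        S.map (R.map (T.map (j.app X)) ≫ a) := by
  have h1 : T.μ.app (L'.obj (S.obj X)) ≫ T.map (j.app X) =
      T.map (T.map (j.app X)) ≫ T.μ.app (L.obj X) := (T.μ.naturality (j.app X)).symm
  have h2 : adj'.counit.app (T.obj (L'.obj (S.obj X))) ≫ T.map (j.app X) =
      j.app _ ≫ L.map (R.map (T.map (j.app X))) ≫ adj.counit.app (T.obj (L.obj X)) := by
    rw [← hj, Category.assoc]
    exact congrArg (j.app (R.obj (T.obj (L'.obj (S.obj X)))) ≫ ·)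
      (adj.counit.naturality (T.map (j.app X))).symm
  have h3 : L'.map (S.map (R.map (T.map (j.app X)) ≫ a)) ≫ j.app X =
      j.app _ ≫ L.map (R.map (T.map (j.app X))) ≫ L.map a := by
    rw [← L.map_comp]
    exact j.naturality (R.map (T.map (j.app X)) ≫ a)
  have h4 : T.map (adj'.counit.app (T.obj (L'.obj (S.obj X))) ≫ T.map (j.app X)) ≫
      T.μ.app (L.obj X) = T.map (adj'.counit.app (T.obj (L'.obj (S.obj X)))) ≫
        T.μ.app (L'.obj (S.obj X)) ≫ T.map (j.app X) := by
    rw [T.map_comp, Category.assoc, h1]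
  rw [← S.map_comp, ← S.map_comp, ← S.map_comp]
  congr 1
  calc _ = R.map (T.map (adj'.counit.app (T.obj (L'.obj (S.obj X))) ≫ T.map (j.app X)) ≫
        T.μ.app (L.obj X)) ≫ a := by
        rw [h4]; simp only [R.map_comp, Category.assoc]
    _ = R.map (T.map (j.app _ ≫ L.map (R.map (T.map (j.app X))))) ≫
        (R.map (T.map (adj.counit.app (T.obj (L.obj X)))) ≫ R.map (T.μ.app (L.obj X))) ≫ a := by
        rw [h2]; simp only [T.map_comp, R.map_comp, Category.assoc]
    _ = R.map (T.map (j.app _ ≫ L.map (R.map (T.map (j.app X))) ≫ L.map a)) ≫ a := by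
        rw [ha]; simp only [T.map_comp, R.map_comp, Category.assoc]
    _ = _ := by
        rw [← h3]; simp only [T.map_comp, R.map_comp, Category.assoc]

theorem algLift_hom {X Y : B} (a : R.obj (T.obj (L.obj X)) ⟶ X) (b : R.obj (T.obj (L.obj Y)) ⟶ Y)
    (f : X ⟶ Y) (hf : R.map (T.map (L.map f)) ≫ b = a ≫ f) :
    S.map (R.map (T.map (L'.map (S.map f)))) ≫ S.map (R.map (T.map (j.app Y)) ≫ b) =
      S.map (R.map (T.map (j.app X)) ≫ a) ≫ S.map f := by
  have h1 : L'.map (S.map f) ≫ j.app Y = j.app X ≫ L.map f := j.naturality f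
  rw [← S.map_comp, ← S.map_comp, Category.assoc, ← hf, ← Category.assoc, ← R.map_comp,
    ← T.map_comp, h1, T.map_comp, R.map_comp, Category.assoc]

theorem comp_adj_counit (X : B) :
    R.map ((adj.comp T.adj).counit.app (T.free.obj (L.obj X))).f =
      R.map (T.map (adj.counit.app (T.obj (L.obj X)))) ≫ R.map (T.μ.app (L.obj X)) := by
  have h := congrArg Monad.Algebra.Hom.f
    (Adjunction.comp_counit_app adj T.adj (T.free.obj (L.obj X)))
  have h1 : (T.adj.counit.app (T.free.obj (L.obj X))).f = T.μ.app (L.obj X) := by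
    simp
    rfl
  have h' : (T.free.map (adj.counit.app (T.forget.obj (T.free.obj (L.obj X)))) ≫
      T.adj.counit.app (T.free.obj (L.obj X))).f =
      T.map (adj.counit.app (T.obj (L.obj X))) ≫ T.μ.app (L.obj X) :=
    congrArg (T.map (adj.counit.app (T.obj (L.obj X))) ≫ ·) h1
  exact (congrArg R.map (h.trans h')).trans (R.map_comp _ _)

end Lift

section Pullback

universe v₁ v₂ v₃ u₁ u₂ u₃

variable {A : Type u₁} [Category.{v₁} A] {B : Type u₂} [Category.{v₂} B]
  {C : Type u₃} [Category.{v₃} C]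

/-- The objects of the (strict) pullback of categories of two functors `F` and `G` with the same
target: pairs of objects with the same image. -/
structure StrictPullback (F : A ⥤ C) (G : B ⥤ C) where
  fst : A
  snd : B
  eq : F.obj fst = G.obj snd

namespace StrictPullback

variable {F : A ⥤ C} {G : B ⥤ C}

/-- The morphisms of the pullback of categories: pairs of morphisms with the same image (up to
the identification of the images of the sources and of the targets). -/
@[ext]
structure Hom (P Q : StrictPullback F G) where
  fst : P.fst ⟶ Q.fst
  snd : P.snd ⟶ Q.snd
  eq : F.map fst ≫ eqToHom Q.eq = eqToHom P.eq ≫ G.map snd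

instance : Category (StrictPullback F G) where
  Hom P Q := Hom P Q
  id P := ⟨𝟙 P.fst, 𝟙 P.snd, by simp⟩
  comp f g := ⟨f.fst ≫ g.fst, f.snd ≫ g.snd, by
    rw [F.map_comp, G.map_comp, Category.assoc, g.eq, ← Category.assoc, f.eq, Category.assoc]⟩
  id_comp f := Hom.ext (Category.id_comp f.fst) (Category.id_comp f.snd)
  comp_id f := Hom.ext (Category.comp_id f.fst) (Category.comp_id f.snd)
  assoc f g h := Hom.ext (Category.assoc f.fst g.fst h.fst) (Category.assoc f.snd g.snd h.snd)

variable (F G) in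
/-- The first projection of the pullback. -/
def fstFunctor : StrictPullback F G ⥤ A where
  obj P := P.fst
  map f := f.fst

variable (F G) in
/-- The second projection of the pullback. -/
def sndFunctor : StrictPullback F G ⥤ B where
  obj P := P.snd
  map f := f.snd

/-- The functor to the pullback induced by two functors with equal composites. -/
def lift {D : Type*} [Category D] (H : D ⥤ A) (K : D ⥤ B) (w : H ⋙ F = K ⋙ G) :
    D ⥤ StrictPullback F G where
  obj d := ⟨H.obj d, K.obj d, Functor.congr_obj w d⟩
  map f := ⟨H.map f, K.map f, by
    have := Functor.congr_hom w f
    simp only [Functor.comp_map] at this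
    simp [this]⟩

end StrictPullback

end Pullback

/-- An `n`-globular set, for `n ∈ ℕ ∪ {ω}` (`ω` is `⊤ : ℕ∞`): sets `cells i` of `i`-globes for
the natural numbers `i ≤ n`, with source and target maps satisfying the globular identities. -/
structure GlobSet (n : ℕ∞) : Type (u + 1) where
  cells : ∀ i : ℕ, (i : ℕ∞) ≤ n → Type u
  src : ∀ (i : ℕ) (h : ((i + 1 : ℕ) : ℕ∞) ≤ n),
    cells (i + 1) h → cells i ((Nat.cast_le.2 i.le_succ).trans h)
  tgt : ∀ (i : ℕ) (h : ((i + 1 : ℕ) : ℕ∞) ≤ n),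
    cells (i + 1) h → cells i ((Nat.cast_le.2 i.le_succ).trans h)
  src_src : ∀ (i : ℕ) (h : ((i + 1 + 1 : ℕ) : ℕ∞) ≤ n) (x : cells (i + 1 + 1) h),
    src i _ (src (i + 1) h x) = src i _ (tgt (i + 1) h x)
  tgt_src : ∀ (i : ℕ) (h : ((i + 1 + 1 : ℕ) : ℕ∞) ≤ n) (x : cells (i + 1 + 1) h),
    tgt i _ (src (i + 1) h x) = tgt i _ (tgt (i + 1) h x)

namespace GlobSet

/-- A morphism of `n`-globular sets: maps on `i`-globes compatible with sources and targets. -/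
@[ext]
structure Hom {n : ℕ∞} (X Y : GlobSet.{u} n) : Type u where
  app : ∀ (i : ℕ) (h : (i : ℕ∞) ≤ n), X.cells i h → Y.cells i h
  src_app : ∀ (i : ℕ) (h : ((i + 1 : ℕ) : ℕ∞) ≤ n) (x : X.cells (i + 1) h),
    Y.src i h (app (i + 1) h x) = app i _ (X.src i h x)
  tgt_app : ∀ (i : ℕ) (h : ((i + 1 : ℕ) : ℕ∞) ≤ n) (x : X.cells (i + 1) h),
    Y.tgt i h (app (i + 1) h x) = app i _ (X.tgt i h x)

instance (n : ℕ∞) : Category (GlobSet.{u} n) where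
  Hom X Y := Hom X Y
  id X := ⟨fun _ _ x => x, fun _ _ _ => rfl, fun _ _ _ => rfl⟩
  comp f g := ⟨fun i h x => g.app i h (f.app i h x),
    fun i h x => by rw [g.src_app, f.src_app], fun i h x => by rw [g.tgt_app, f.tgt_app]⟩

theorem hom_ext {n : ℕ∞} {X Y : GlobSet.{u} n} {f g : X ⟶ Y}
    (w : ∀ (i : ℕ) (h : (i : ℕ∞) ≤ n) (x : X.cells i h), f.app i h x = g.app i h x) : f = g :=
  Hom.ext (funext fun i => funext fun h => funext fun x => w i h x)

@[simp]
theorem id_app {n : ℕ∞} (X : GlobSet.{u} n) (i : ℕ) (h : (i : ℕ∞) ≤ n) (x : X.cells i h) :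
    Hom.app (𝟙 X) i h x = x := rfl

@[simp]
theorem comp_app {n : ℕ∞} {X Y Z : GlobSet.{u} n} (f : X ⟶ Y) (g : Y ⟶ Z) (i : ℕ)
    (h : (i : ℕ∞) ≤ n) (x : X.cells i h) : (f ≫ g).app i h x = g.app i h (f.app i h x) := rfl

/-- The `m`-truncation of `n`-globular sets, for `m ≤ n`: forget the `i`-globes with `i > m`. -/
def trunc {m n : ℕ∞} (hmn : m ≤ n) : GlobSet.{u} n ⥤ GlobSet.{u} m where
  obj X :=
    { cells := fun i h => X.cells i (h.trans hmn)
      src := fun i h => X.src i (h.trans hmn)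
      tgt := fun i h => X.tgt i (h.trans hmn)
      src_src := fun i h => X.src_src i (h.trans hmn)
      tgt_src := fun i h => X.tgt_src i (h.trans hmn) }
  map f :=
    { app := fun i h => f.app i (h.trans hmn)
      src_app := fun i h => f.src_app i (h.trans hmn)
      tgt_app := fun i h => f.tgt_app i (h.trans hmn) }

@[simp]
theorem trunc_map_app {m n : ℕ∞} (hmn : m ≤ n) {X Y : GlobSet.{u} n} (f : X ⟶ Y) (i : ℕ)
    (h : (i : ℕ∞) ≤ m) (x : X.cells i (h.trans hmn)) :
    ((trunc hmn).map f).app i h x = f.app i (h.trans hmn) x := rfl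

open Classical in
/-- The `i`-globes of the inclusion of an `m`-globular set `X` in higher dimension: those of `X`
if `i ≤ m`, and none if `i > m`. -/
def InclCells {m : ℕ∞} (X : GlobSet.{u} m) (i : ℕ) : Type u :=
  if h : (i : ℕ∞) ≤ m then X.cells i h else PEmpty.{u + 1}

/-- The identification of `InclCells X i` with `X.cells i` (which is an equality) for `i ≤ m`. -/
def inclEquiv {m : ℕ∞} (X : GlobSet.{u} m) {i : ℕ} (h : (i : ℕ∞) ≤ m) :
    InclCells X i ≃ X.cells i h :=
  Equiv.cast (dif_pos h)

theorem InclCells.le {m : ℕ∞} {X : GlobSet.{u} m} {i : ℕ} (x : InclCells X i) :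
    (i : ℕ∞) ≤ m := by
  by_contra h
  exact (cast (dif_neg h) x : PEmpty.{u + 1}).elim

/-- The inclusion of `m`-globular sets into `n`-globular sets, adding no globe. -/
def incl {m n : ℕ∞} (_hmn : m ≤ n) : GlobSet.{u} m ⥤ GlobSet.{u} n where
  obj X :=
    { cells := fun i _ => InclCells X i
      src := fun i _ x => (inclEquiv X _).symm (X.src i x.le (inclEquiv X x.le x))
      tgt := fun i _ x => (inclEquiv X _).symm (X.tgt i x.le (inclEquiv X x.le x))
      src_src := fun i _ x => by simp [X.src_src]
      tgt_src := fun i _ x => by simp [X.tgt_src] }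
  map {X Y} f :=
    { app := fun i _ x => (inclEquiv Y x.le).symm (f.app i x.le (inclEquiv X x.le x))
      src_app := fun i _ x => by simp [f.src_app]
      tgt_app := fun i _ x => by simp [f.tgt_app] }
  map_id X := hom_ext fun i h x => by simp
  map_comp f g := hom_ext fun i h x => by simp

/-- The adjunction between inclusion and truncation. Its unit is the identification of `X` with
the truncation of its inclusion, its counit is the canonical morphism from the inclusion of the
truncation of `X` to `X`. -/
def inclTruncAdj {m n : ℕ∞} (hmn : m ≤ n) : incl.{u} hmn ⊣ trunc.{u} hmn :=
  Adjunction.mkOfUnitCounit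
    { unit :=
        { app := fun X =>
            { app := fun i h => (inclEquiv X h).symm
              src_app := fun i h x => by simp [trunc, incl]
              tgt_app := fun i h x => by simp [trunc, incl] }
          naturality := fun X Y f => hom_ext fun i h x => by simp [trunc, incl] }
      counit :=
        { app := fun X =>
            { app := fun _ _ x => inclEquiv ((trunc hmn).obj X) x.le x
              src_app := fun _ _ _ => (Equiv.apply_symm_apply _ _).symm
              tgt_app := fun _ _ _ => (Equiv.apply_symm_apply _ _).symm }
          naturality := fun _ _ _ => hom_ext fun _ _ _ => Equiv.apply_symm_apply _ _ }
      left_triangle := by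
        ext X
        exact hom_ext fun _ _ _ =>
          (Equiv.apply_symm_apply _ _).trans (Equiv.symm_apply_apply _ _)
      right_triangle := by
        ext X
        exact hom_ext fun _ h x => Equiv.apply_symm_apply (inclEquiv ((trunc hmn).obj X) h) x }

/-- For `k ≤ l ≤ n`, the canonical morphism, natural in the `l`-globular set `X`, from the
`n`-inclusion of the `k`-truncation of `X` to the `n`-inclusion of `X`. -/
def inclTruncHom {k l n : ℕ∞} (hkl : k ≤ l) (hln : l ≤ n) :
    trunc.{u} hkl ⋙ incl.{u} (hkl.trans hln) ⟶ incl.{u} hln where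
  app X :=
    { app := fun _ _ x =>
        (inclEquiv X (x.le.trans hkl)).symm (inclEquiv ((trunc hkl).obj X) x.le x)
      src_app := fun i _ x => congrArg (inclEquiv X _).symm <|
        (congrArg (X.src i _) (Equiv.apply_symm_apply (inclEquiv X _) _)).trans
          (Equiv.apply_symm_apply (inclEquiv ((trunc hkl).obj X) _) _).symm
      tgt_app := fun i _ x => congrArg (inclEquiv X _).symm <|
        (congrArg (X.tgt i _) (Equiv.apply_symm_apply (inclEquiv X _) _)).trans
          (Equiv.apply_symm_apply (inclEquiv ((trunc hkl).obj X) _) _).symm }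
  naturality X Y f := hom_ext fun i h x => congrArg (inclEquiv Y (x.le.trans hkl)).symm <| by
    refine (Equiv.apply_symm_apply (inclEquiv ((trunc hkl).obj Y) x.le) _).trans ?_
    exact congrArg (f.app i (x.le.trans hkl))
      (Equiv.apply_symm_apply (inclEquiv X (x.le.trans hkl)) _).symm

theorem inclTruncHom_counit {k l n : ℕ∞} (hkl : k ≤ l) (hln : l ≤ n) (X : GlobSet.{u} n) :
    (inclTruncHom hkl hln).app ((trunc hln).obj X) ≫ (inclTruncAdj hln).counit.app X =
      (inclTruncAdj (hkl.trans hln)).counit.app X :=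
  hom_ext fun _ _ x =>
    Equiv.apply_symm_apply (inclEquiv ((trunc hln).obj X) (x.le.trans hkl)) _

theorem unit_inclTruncHom {k l n : ℕ∞} (hkl : k ≤ l) (hln : l ≤ n) (X : GlobSet.{u} l) :
    (inclTruncAdj (hkl.trans hln)).unit.app ((trunc hkl).obj X) ≫
        (trunc (hkl.trans hln)).map ((inclTruncHom hkl hln).app X) =
      (trunc hkl).map ((inclTruncAdj hln).unit.app X) :=
  hom_ext fun _ h x => congrArg (inclEquiv X (h.trans hkl)).symm
    (Equiv.apply_symm_apply (inclEquiv ((trunc hkl).obj X) h) x)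

end GlobSet

open GlobSet

section Algebras

variable {n : ℕ∞} (T : Monad (GlobSet.{u} n))

/-- The monad `Tᵏ` on `k`-globular sets induced by a monad `T` on `n`-globular sets, for `k ≤ n`:
its functor sends `X` to the `k`-truncation of `T` applied to the `n`-inclusion of `X`. It is the
monad of the composite of the adjunctions inclusion ⊣ truncation and free ⊣ forgetful between
`k`-globular sets, `n`-globular sets and `T`-algebras. For `k = n` it is `T` itself. -/
def truncMonad {k : ℕ∞} (hk : k ≤ n) : Monad (GlobSet.{u} k) :=
  ((inclTruncAdj hk).comp T.adj).toMonad

@[simp]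
theorem truncMonad_obj {k : ℕ∞} (hk : k ≤ n) (X : GlobSet.{u} k) :
    (truncMonad T hk).obj X = (trunc hk).obj (T.obj ((incl hk).obj X)) := rfl

@[simp]
theorem truncMonad_map {k : ℕ∞} (hk : k ≤ n) {X Y : GlobSet.{u} k} (f : X ⟶ Y) :
    (truncMonad T hk).map f = (trunc hk).map (T.map ((incl hk).map f)) := rfl

theorem truncMonad_η_app {k : ℕ∞} (hk : k ≤ n) (X : GlobSet.{u} k) :
    (truncMonad T hk).η.app X =
      (inclTruncAdj hk).unit.app X ≫ (trunc hk).map (T.η.app ((incl hk).obj X)) :=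
  Adjunction.comp_unit_app _ _ _

theorem truncMonad_μ_app {k : ℕ∞} (hk : k ≤ n) (X : GlobSet.{u} k) :
    (truncMonad T hk).μ.app X =
      (trunc hk).map (T.map ((inclTruncAdj hk).counit.app (T.obj ((incl hk).obj X)))) ≫
        (trunc hk).map (T.μ.app ((incl hk).obj X)) :=
  comp_adj_counit T (inclTruncAdj hk) X

/-- The category of `k`-categories: the algebras of `Tᵏ`. -/
abbrev GlobAlg {k : ℕ∞} (hk : k ≤ n) := (truncMonad T hk).Algebra

/-- The natural transformation from `Tᵏ` after `k`-truncation to `k`-truncation after `T`, whose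
component at `X` is the truncation of the image by `T` of the counit at `X`. -/
def monTrunc {k : ℕ∞} (hk : k ≤ n) :
    trunc.{u} hk ⋙ (truncMonad T hk).toFunctor ⟶ T.toFunctor ⋙ trunc.{u} hk where
  app X := (trunc hk).map (T.map ((inclTruncAdj hk).counit.app X))
  naturality _ _ f := (Functor.whiskerRight
    (Functor.whiskerRight (inclTruncAdj hk).counit T.toFunctor) (trunc hk)).naturality f

/-- `T` is truncable when `monTrunc T` is the identity natural transformation for each `k < n`;
in particular, `Tᵏ` after `k`-truncation is equal to `k`-truncation after `T`. -/
def IsTruncable : Prop :=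
  ∀ (k : ℕ) (hk : (k : ℕ∞) < n),
    ∃ e : trunc.{u} hk.le ⋙ (truncMonad T hk.le).toFunctor = T.toFunctor ⋙ trunc.{u} hk.le,
      monTrunc T hk.le = eqToHom e

/-- The `k`-truncation of `l`-categories, for `k ≤ l ≤ n`: it sends `(X, h)` to the
`k`-truncation of `X`, with structure morphism the composite of the canonical morphism from
`Tᵏ` of the truncation of `X` to the truncation of `Tˡ X` with the truncation of `h`. -/
def algTrunc {k l : ℕ∞} (hkl : k ≤ l) (hln : l ≤ n) :
    GlobAlg T hln ⥤ GlobAlg T (hkl.trans hln) where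
  obj C :=
    { A := (trunc hkl).obj C.A
      a := (trunc hkl).map ((trunc hln).map (T.map ((inclTruncHom hkl hln).app C.A)) ≫ C.a)
      unit := by
        rw [truncMonad_η_app]
        exact algLift_unit T (inclTruncAdj hln) (trunc hkl) (inclTruncAdj (hkl.trans hln))
          (inclTruncHom hkl hln) (unit_inclTruncHom hkl hln) C.A C.a
          ((congrArg (· ≫ C.a) (truncMonad_η_app T hln C.A)).symm.trans C.unit)
      assoc := by
        rw [truncMonad_μ_app]
        exact algLift_assoc T (inclTruncAdj hln) (trunc hkl) (inclTruncAdj (hkl.trans hln))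
          (inclTruncHom hkl hln) (inclTruncHom_counit hkl hln) C.A C.a
          ((congrArg (· ≫ C.a) (truncMonad_μ_app T hln C.A)).symm.trans C.assoc) }
  map f :=
    { f := (trunc hkl).map f.f
      h := algLift_hom T (R := trunc hln) (trunc hkl) (inclTruncHom hkl hln) _ _ f.f f.h }

/-- The category of `k`-cellular extensions, for `k + 1 ≤ n`: the pullback of categories of the
forgetful functor from `k`-categories to `k`-globular sets along the `k`-truncation of
`(k+1)`-globular sets. -/
abbrev CellExt (k : ℕ) (hk : ((k + 1 : ℕ) : ℕ∞) ≤ n) :=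
  StrictPullback (truncMonad T ((Nat.cast_le.2 k.le_succ).trans hk)).forget
    (trunc.{u} (Nat.cast_le.2 k.le_succ : (k : ℕ∞) ≤ ((k + 1 : ℕ) : ℕ∞)))

/-- The `k`-truncation functor from `(k+1)`-categories to `k`-categories. -/
abbrev algTruncSucc (k : ℕ) (hk : ((k + 1 : ℕ) : ℕ∞) ≤ n) :
    GlobAlg T hk ⥤ GlobAlg T ((Nat.cast_le.2 k.le_succ : (k : ℕ∞) ≤ _).trans hk) :=
  algTrunc T (Nat.cast_le.2 k.le_succ) hk

/-- The functor sending a `k`-cellular extension `(C, X)` to its underlying `k`-category `C`. -/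
abbrev cellExtAlg (k : ℕ) (hk : ((k + 1 : ℕ) : ℕ∞) ≤ n) :
    CellExt T k hk ⥤ GlobAlg T ((Nat.cast_le.2 k.le_succ : (k : ℕ∞) ≤ _).trans hk) :=
  StrictPullback.fstFunctor _ _

/-- The functor sending a `(k+1)`-category `D` to the `k`-cellular extension made of the
`k`-truncation of `D` and the underlying `(k+1)`-globular set of `D`. -/
def algToCellExt (k : ℕ) (hk : ((k + 1 : ℕ) : ℕ∞) ≤ n) : GlobAlg T hk ⥤ CellExt T k hk :=
  StrictPullback.lift (algTruncSucc T k hk) (truncMonad T hk).forget rfl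

end Algebras

/-! Write `V` for `algToCellExt T k hk`.

Existence of the left adjoint: it suffices to give, for each cellular extension `(C, X)`, an initial
object of the comma category of arrows `(C, X) ⟶ V E`. Consider all such arrows at once and generate
by `X` a "subalgebra of the product of all the `E`" (`exists_generated_algebra`). The family may be
large, but each stage of the generation is a quotient of a small globular set, so the product itself
is never needed. Finitarity lets the generation stop at the union of a sequence. The result `Q` maps
to every `E`, compatibly with `X`, and uniquely because `X` generates it.

Invertibility of the unit: truncability makes `Tᵏ` of a truncation agree with the truncation of
`Tᵏ⁺¹`, so the coskeleton `R` of a `k`-category `D`, with one `(k+1)`-globe per parallel pair, is a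
`(k+1)`-category (`IsTruncable.exists_cosk_algebra`). Since a top globe of `R` carries no
information beyond its boundary, `Hom(C[X]_{≤k}, D) ≅ Hom(C[X], R) ≅ Hom((C, X), V R) ≅ Hom(C, D)`.
The composite is precomposition with the unit component, and Yoneda concludes. -/

namespace GlobSet

universe w

/-! ### Joint images of possibly large families of morphisms. -/

section JointImage

variable {m : ℕ∞} {ι : Type} {J : Type w} {D : J → GlobSet.{u} m} {Y : ι → GlobSet.{u} m}
  (v : ∀ i j, Y i ⟶ D j)

/-- Two globes of a family of globular sets are identified when a given family of morphisms
does not separate them. -/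
def jointSetoid (i : ℕ) (h : (i : ℕ∞) ≤ m) : Setoid (Σ a, (Y a).cells i h) where
  r x y := ∀ j, (v x.1 j).app i h x.2 = (v y.1 j).app i h y.2
  iseqv := ⟨fun _ _ => rfl, fun e j => (e j).symm, fun e e' j => (e j).trans (e' j)⟩

/-- The joint image of a family of morphisms `Y a ⟶ D j`: the quotient of the coproduct of the
`Y a` that identifies the globes not separated by the morphisms to the `D j`. -/
def jointImage : GlobSet.{u} m where
  cells i h := Quotient (jointSetoid v i h)
  src i h := Quotient.map' (fun x => ⟨x.1, (Y x.1).src i h x.2⟩) fun x y e j => by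
    simp only [← Hom.src_app]
    exact congrArg _ (e j)
  tgt i h := Quotient.map' (fun x => ⟨x.1, (Y x.1).tgt i h x.2⟩) fun x y e j => by
    simp only [← Hom.tgt_app]
    exact congrArg _ (e j)
  src_src i h := by
    rintro ⟨a, x⟩
    exact congrArg (fun y => Quotient.mk _ (Sigma.mk a y)) ((Y a).src_src i h x)
  tgt_src i h := by
    rintro ⟨a, x⟩
    exact congrArg (fun y => Quotient.mk _ (Sigma.mk a y)) ((Y a).tgt_src i h x)

/-- The morphism from a member of the family to the joint image. -/
def jointImageIn (a : ι) : Y a ⟶ jointImage v where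
  app _ _ x := Quotient.mk _ ⟨a, x⟩
  src_app _ _ _ := rfl
  tgt_app _ _ _ := rfl

/-- The morphism from the joint image to a member of the target family. -/
def jointImageOut (j : J) : jointImage v ⟶ D j where
  app i h := Quotient.lift (fun x => (v x.1 j).app i h x.2) fun _ _ e => e j
  src_app i h := by
    rintro ⟨a, x⟩
    exact (v a j).src_app i h x
  tgt_app i h := by
    rintro ⟨a, x⟩
    exact (v a j).tgt_app i h x

theorem jointImageIn_out (a : ι) (j : J) : jointImageIn v a ≫ jointImageOut v j = v a j := rfl

theorem jointImageIn_surj {i : ℕ} {h : (i : ℕ∞) ≤ m} (x : (jointImage v).cells i h) :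
    ∃ a y, (jointImageIn v a).app i h y = x := by
  obtain ⟨⟨a, y⟩, rfl⟩ := Quotient.exists_rep x
  exact ⟨a, y, rfl⟩

/-- A family of morphisms with the same source that separates globes. -/
def JointlyInjective {Q : GlobSet.{u} m} (w : ∀ j, Q ⟶ D j) : Prop :=
  ∀ (i : ℕ) (h : (i : ℕ∞) ≤ m) (x y : Q.cells i h),
    (∀ j, (w j).app i h x = (w j).app i h y) → x = y

theorem jointImageOut_jointlyInjective : JointlyInjective (jointImageOut v) := by
  rintro i h ⟨a, x⟩ ⟨b, y⟩ e
  exact Quotient.sound e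

theorem JointlyInjective.hom_ext {Q : GlobSet.{u} m} {w : ∀ j, Q ⟶ D j}
    (hw : JointlyInjective w) {Z : GlobSet.{u} m} {f g : Z ⟶ Q} (e : ∀ j, f ≫ w j = g ≫ w j) :
    f = g :=
  GlobSet.hom_ext fun i h x => hw i h _ _ fun j =>
    congrArg (fun t : Z ⟶ D j => Hom.app t i h x) (e j)

/-- Lifts may be chosen globe by globe: separation by the `w j` forces the choices to respect
sources and targets. -/
theorem JointlyInjective.exists_lift {Q : GlobSet.{u} m} {w : ∀ j, Q ⟶ D j}
    (hw : JointlyInjective w) {Z : GlobSet.{u} m} (g : ∀ j, Z ⟶ D j)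
    (hg : ∀ (i : ℕ) (h : (i : ℕ∞) ≤ m) (z : Z.cells i h), ∃ q : Q.cells i h,
      ∀ j, (w j).app i h q = (g j).app i h z) :
    ∃ f : Z ⟶ Q, ∀ j, f ≫ w j = g j := by
  choose f hf using hg
  refine ⟨⟨f, fun i h x => hw _ _ _ _ fun j => ?_, fun i h x => hw _ _ _ _ fun j => ?_⟩,
    fun j => GlobSet.hom_ext fun i h x => hf i h x j⟩
  · rw [← Hom.src_app, hf, hf, Hom.src_app]
  · rw [← Hom.tgt_app, hf, hf, Hom.tgt_app]

end JointImage

/-- Every globe of a colimit of globular sets comes from some object of the diagram. -/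
theorem exists_rep_of_isColimit {m : ℕ∞} {K : Type*} [Category K] {F : K ⥤ GlobSet.{u} m}
    {c : Cocone F} (hc : IsColimit c) {i : ℕ} {h : (i : ℕ∞) ≤ m} (x : c.pt.cells i h) :
    ∃ a y, (c.ι.app a).app i h y = x := by
  let P : GlobSet.{u} m :=
    { cells := fun i h => {x : c.pt.cells i h // ∃ a y, (c.ι.app a).app i h y = x}
      src := fun i h x => ⟨c.pt.src i h x.1, by
        obtain ⟨_, a, y, rfl⟩ := x
        exact ⟨a, (F.obj a).src i h y, ((c.ι.app a).src_app i h y).symm⟩⟩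
      tgt := fun i h x => ⟨c.pt.tgt i h x.1, by
        obtain ⟨_, a, y, rfl⟩ := x
        exact ⟨a, (F.obj a).tgt i h y, ((c.ι.app a).tgt_app i h y).symm⟩⟩
      src_src := fun i h x => Subtype.ext (c.pt.src_src i h x.1)
      tgt_src := fun i h x => Subtype.ext (c.pt.tgt_src i h x.1) }
  let p : P ⟶ c.pt := ⟨fun _ _ x => x.1, fun _ _ _ => rfl, fun _ _ _ => rfl⟩
  let s : Cocone F :=
    { pt := P
      ι :=
        { app := fun a => ⟨fun i h y => ⟨(c.ι.app a).app i h y, a, y, rfl⟩,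
            fun i h y => Subtype.ext ((c.ι.app a).src_app i h y),
            fun i h y => Subtype.ext ((c.ι.app a).tgt_app i h y)⟩
          naturality := fun a b f => GlobSet.hom_ext fun i h y => Subtype.ext <|
            congrArg (fun t : F.obj a ⟶ c.pt => Hom.app t i h y) (c.w f) } }
  -- The inclusion `p` of the represented globes has a section, so every globe is represented.
  have e : hc.desc s ≫ p = 𝟙 c.pt := hc.hom_ext fun a => by
    rw [hc.fac_assoc, Category.comp_id]
    rfl
  have e' : ((hc.desc s).app i h x).1 = x :=
    congrArg (fun t : c.pt ⟶ c.pt => Hom.app t i h x) e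
  obtain ⟨a, y, hy⟩ := ((hc.desc s).app i h x).2
  exact ⟨a, y, hy.trans e'⟩

/-! ### Unions of sequences as colimits. -/

section Sequence

variable {m : ℕ∞} {J : Type w} {D : J → GlobSet.{u} m} {Y : ℕ → GlobSet.{u} m}
  (v : ∀ a j, Y a ⟶ D j) (t : ∀ a, Y a ⟶ Y (a + 1))

/-- The diagram of a sequence of morphisms, indexed by a lift of the natural numbers. -/
def sequence : ULift.{u} ℕ ⥤ GlobSet.{u} m :=
  (show Monotone (ULift.down : ULift.{u} ℕ → ℕ) from fun _ _ h => h).functor ⋙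
    Functor.ofSequence t

theorem sequence_map_comp (ht : ∀ a j, t a ≫ v (a + 1) j = v a j) (j : J)
    {a b : ULift.{u} ℕ} (f : a ⟶ b) :
    (sequence t).map f ≫ v b.down j = v a.down j := by
  let α : Functor.ofSequence t ⟶ (Functor.const ℕ).obj (D j) :=
    NatTrans.ofSequence (fun a => v a j) fun a => by
      rw [Functor.ofSequence_map_homOfLE_succ]
      exact (ht a j).trans (Category.comp_id _).symm
  exact (α.naturality ((show Monotone (ULift.down : ULift.{u} ℕ → ℕ) from
    fun _ _ h => h).functor.map f)).trans (Category.comp_id _)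

/-- The cocone with point the joint image on a sequence of globular sets. -/
def jointImageCocone (ht : ∀ a j, t a ≫ v (a + 1) j = v a j) : Cocone (sequence t) where
  pt := jointImage v
  ι :=
    { app := fun a => jointImageIn v a.down
      naturality := fun a b f => (jointImageOut_jointlyInjective v).hom_ext fun j => by
        exact (sequence_map_comp v t ht j f) }

/-- Two globes identified in the joint image can be moved to the later of their two stages `a`;
there `v a` is jointly injective, so they are already equal. Hence the joint image is the union of
the stages. -/
theorem jointImageCocone_isColimit (ht : ∀ a j, t a ≫ v (a + 1) j = v a j)
    (hv : ∀ a, JointlyInjective (v a)) :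
    Nonempty (IsColimit (jointImageCocone v t ht)) := by
  have key (s : Cocone (sequence t)) (a b : ℕ) (hab : a ≤ b) (i : ℕ) (h : (i : ℕ∞) ≤ m)
      (x : (Y a).cells i h) : ∃ y : (Y b).cells i h,
      (s.ι.app ⟨a⟩).app i h x = (s.ι.app ⟨b⟩).app i h y ∧
        ∀ j, (v a j).app i h x = (v b j).app i h y := by
    let f : (⟨a⟩ : ULift.{u} ℕ) ⟶ ⟨b⟩ := homOfLE hab
    refine ⟨((sequence t).map f).app i h x, ?_, fun j => ?_⟩
    · exact (congrArg (fun g : Y a ⟶ s.pt => Hom.app g i h x) (s.w f)).symm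
    · exact (congrArg (fun g : Y a ⟶ D j => Hom.app g i h x)
        (sequence_map_comp v t ht j f)).symm
  exact ⟨{
    desc := fun s =>
      { app := fun i h => Quotient.lift (fun x => (s.ι.app ⟨x.1⟩).app i h x.2) fun x y e => by
          obtain ⟨x', hx, hx'⟩ := key s x.1 (max x.1 y.1) (le_max_left _ _) i h x.2
          obtain ⟨y', hy, hy'⟩ := key s y.1 (max x.1 y.1) (le_max_right _ _) i h y.2
          simp only [hx, hy]
          exact congrArg _ (hv _ _ _ _ _ fun j => by rw [← hx', ← hy']; exact e j)
        src_app := by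
          rintro i h ⟨a, x⟩
          exact (s.ι.app ⟨a⟩).src_app i h x
        tgt_app := by
          rintro i h ⟨a, x⟩
          exact (s.ι.app ⟨a⟩).tgt_app i h x }
    fac := fun s a => rfl
    uniq := fun s f hf => GlobSet.hom_ext fun i h => by
      rintro ⟨a, x⟩
      exact congrArg (fun g : Y a ⟶ s.pt => Hom.app g i h x) (hf ⟨a⟩) }⟩

end Sequence

end GlobSet

theorem unit_map_algebra {C : Type*} [Category* C] (S : Monad C) (D : S.Algebra) {Y : C}
    (g : Y ⟶ D.A) : S.η.app Y ≫ S.map g ≫ D.a = g := by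
  have h := S.η.naturality_assoc g D.a
  rw [D.unit] at h
  exact h.symm.trans (Category.comp_id g)

/-! ### The algebra generated by a globular set in a family of algebras. -/

section Generated

universe w

variable {m : ℕ∞} (S : Monad (GlobSet.{u} m)) {J : Type w} (D : J → S.Algebra)
  {X : GlobSet.{u} m} (f : ∀ j, X ⟶ (D j).A)

/-- The successive steps in the generation by `X` of the joint image of `X` in a family of
algebras, with their morphisms to the members of the family. -/
def generationStep : ℕ → Σ Y : GlobSet.{u} m, ∀ j, Y ⟶ (D j).A
  | 0 => ⟨_, jointImageOut fun (_ : Unit) j => f j⟩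
  | a + 1 => ⟨_, jointImageOut fun (_ : Unit) j => S.map ((generationStep a).2 j) ≫ (D j).a⟩

theorem generationStep_jointlyInjective :
    ∀ a, JointlyInjective (generationStep S D f a).2
  | 0 => jointImageOut_jointlyInjective _
  | _ + 1 => jointImageOut_jointlyInjective _

/-- The structure morphism from one step of the generation to the next. -/
def generationOp (a : ℕ) :
    S.obj (generationStep S D f a).1 ⟶ (generationStep S D f (a + 1)).1 :=
  jointImageIn (fun (_ : Unit) j => S.map ((generationStep S D f a).2 j) ≫ (D j).a) ()

theorem generationOp_comp (a : ℕ) (j : J) :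
    generationOp S D f a ≫ (generationStep S D f (a + 1)).2 j =
      S.map ((generationStep S D f a).2 j) ≫ (D j).a := rfl

theorem generationOp_surj (a : ℕ) {i : ℕ} {h : (i : ℕ∞) ≤ m}
    (x : (generationStep S D f (a + 1)).1.cells i h) :
    ∃ y, (generationOp S D f a).app i h y = x := by
  obtain ⟨_, y, hy⟩ := jointImageIn_surj _ x
  exact ⟨y, hy⟩

theorem generation_unit_comp (a : ℕ) (j : J) :
    (S.η.app _ ≫ generationOp S D f a) ≫ (generationStep S D f (a + 1)).2 j =
      (generationStep S D f a).2 j := by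
  rw [Category.assoc, generationOp_comp]
  exact unit_map_algebra S (D j) _

/-- A family of morphisms from `X` to algebras of a monad with rank `ℵ₀` factors through a jointly
monic family of morphisms of algebras from an algebra generated by `X`. -/
theorem exists_generated_algebra
    (hS : ∀ (F : ULift.{u} ℕ ⥤ GlobSet.{u} m) (c : Cocone F), IsColimit c →
      ∀ (i : ℕ) (h : (i : ℕ∞) ≤ m) (x : (S.obj c.pt).cells i h),
        ∃ a y, (S.map (c.ι.app a)).app i h y = x) :
    ∃ (Q : S.Algebra) (p : X ⟶ Q.A) (v : ∀ j, Q ⟶ D j), (∀ j, p ≫ (v j).f = f j) ∧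
      JointlyInjective (fun j => (v j).f) ∧
      ∀ (E : S.Algebra) (g g' : Q ⟶ E), p ≫ g.f = p ≫ g'.f → g = g' := by
  let v := fun a j => (generationStep S D f a).2 j
  let c := jointImageCocone v (fun a => S.η.app _ ≫ generationOp S D f a)
    (generation_unit_comp S D f)
  obtain ⟨hc⟩ := jointImageCocone_isColimit v _ (generation_unit_comp S D f)
    (generationStep_jointlyInjective S D f)
  let w := jointImageOut v
  have hw : JointlyInjective w := jointImageOut_jointlyInjective v
  have hin (a : ℕ) (j : J) : jointImageIn v a ≫ w j = v a j := jointImageIn_out v a j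
  -- By `hS`, a globe of `S` of the union comes from `S` of some stage `a`; its images in the `D j`
  -- are therefore those of one globe of stage `a + 1`.
  obtain ⟨q, hq⟩ := hw.exists_lift (fun j => S.map (w j) ≫ (D j).a) fun i h z => by
    obtain ⟨⟨a⟩, y, rfl⟩ := hS _ c hc i h z
    refine ⟨(jointImageIn v (a + 1)).app i h ((generationOp S D f a).app i h y), fun j => ?_⟩
    have e : generationOp S D f a ≫ jointImageIn v (a + 1) ≫ w j =
        S.map (jointImageIn v a) ≫ S.map (w j) ≫ (D j).a := by
      rw [← S.map_comp_assoc, hin, hin]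
      exact generationOp_comp S D f a j
    exact congrArg (fun g => Hom.app g i h y) e
  have hstep (a : ℕ) : generationOp S D f a ≫ jointImageIn v (a + 1) =
      S.map (jointImageIn v a) ≫ q := hw.hom_ext fun j => by
    rw [Category.assoc, Category.assoc, hq, ← S.map_comp_assoc, hin, hin]
    exact generationOp_comp S D f a j
  -- The algebra laws hold in each `D j`, and the `w j` are jointly monic.
  let Q : S.Algebra :=
    { A := jointImage v
      a := q
      unit := hw.hom_ext fun j => by
        rw [Category.assoc, hq]
        exact (unit_map_algebra S (D j) _).trans (Category.id_comp (w j)).symm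
      assoc := hw.hom_ext fun j => by
        rw [Category.assoc, Category.assoc, hq, ← S.mu_naturality_assoc, (D j).assoc,
          ← S.map_comp_assoc, ← S.map_comp_assoc, hq] }
  refine ⟨Q, jointImageIn (fun (_ : Unit) j => f j) () ≫ jointImageIn v 0,
    fun j => ⟨w j, (hq j).symm⟩,
    fun j => ?_, hw, fun E g g' e => ?_⟩
  · rfl
  -- Stage `0` is covered by `X` and stage `a + 1` by `S` of stage `a`, on which a morphism of
  -- algebras is determined by its values on stage `a`.
  · have main (a : ℕ) : jointImageIn v a ≫ g.f = jointImageIn v a ≫ g'.f := by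
      induction a with
      | zero =>
        refine GlobSet.hom_ext fun i h x => ?_
        obtain ⟨_, y, rfl⟩ := jointImageIn_surj _ x
        exact congrArg (fun t => Hom.app t i h y) e
      | succ a ih =>
        have e' : generationOp S D f a ≫ jointImageIn v (a + 1) ≫ g.f =
            generationOp S D f a ≫ jointImageIn v (a + 1) ≫ g'.f := by
          rw [← Category.assoc, ← Category.assoc, hstep, Category.assoc, Category.assoc]
          have h1 : q ≫ g.f = S.map g.f ≫ E.a := g.h.symm
          have h2 : q ≫ g'.f = S.map g'.f ≫ E.a := g'.h.symm
          rw [h1, h2, ← S.map_comp_assoc, ih, S.map_comp_assoc]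
        refine GlobSet.hom_ext fun i h x => ?_
        obtain ⟨y, rfl⟩ := generationOp_surj S D f a x
        exact congrArg (fun t => Hom.app t i h y) e'
    ext
    refine GlobSet.hom_ext fun i h x => ?_
    obtain ⟨a, y, rfl⟩ := jointImageIn_surj v x
    exact congrArg (fun t => Hom.app t i h y) (main a)

end Generated

/-! ### Existence of free extensions. -/

/-- Inclusion is a left adjoint and `T` is finitary, so `T` of the inclusion preserves the colimit;
truncation only restricts to the globes of dimension at most `m`. The shape `ULift ℕ` puts the
sequence in the universe where `T` preserves filtered colimits. -/
theorem truncMonad_exists_rep {n : ℕ∞} (T : Monad (GlobSet.{u} n))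
    [PreservesFilteredColimits T.toFunctor] {m : ℕ∞} (hm : m ≤ n)
    (F : ULift.{u} ℕ ⥤ GlobSet.{u} m) (c : Cocone F) (hc : IsColimit c)
    (i : ℕ) (h : (i : ℕ∞) ≤ m) (x : ((truncMonad T hm).obj c.pt).cells i h) :
    ∃ a y, ((truncMonad T hm).map (c.ι.app a)).app i h y = x := by
  have : PreservesColimitsOfShape (ULift.{u} ℕ) T.toFunctor :=
    PreservesFilteredColimitsOfSize.preserves_filtered_colimits _
  have : (incl.{u} hm).IsLeftAdjoint := (inclTruncAdj hm).isLeftAdjoint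
  exact exists_rep_of_isColimit
    (isColimitOfPreserves T.toFunctor (isColimitOfPreserves (incl hm) hc)) (h := h.trans hm) x

/-- Compatibility with the structure maps can be tested after the `w j`, where it holds because each
`p ≫ (w j).f` underlies a morphism of algebras. -/
theorem algebraHom_of_jointlyMonic {C : Type*} [Category* C] (M : Monad C) {A B : M.Algebra}
    (p : A.A ⟶ B.A) {J : Type*} {E : J → M.Algebra} (w : ∀ j, B ⟶ E j)
    (hw : ∀ {Z : C} (f g : Z ⟶ B.A), (∀ j, f ≫ (w j).f = g ≫ (w j).f) → f = g)
    (g : ∀ j, A ⟶ E j) (hp : ∀ j, p ≫ (w j).f = (g j).f) : M.map p ≫ B.a = A.a ≫ p :=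
  hw _ _ fun j => by
    rw [Category.assoc, Category.assoc, hp, ← (w j).h, ← (g j).h, ← hp, M.map_comp_assoc]

theorem algToCellExt_isRightAdjoint {n : ℕ∞} (T : Monad (GlobSet.{u} n))
    [PreservesFilteredColimits T.toFunctor] (k : ℕ) (hk : ((k + 1 : ℕ) : ℕ∞) ≤ n) :
    (algToCellExt T k hk).IsRightAdjoint := by
  suffices ∀ CX, HasInitial (StructuredArrow CX (algToCellExt T k hk)) from
    isRightAdjointOfStructuredArrowInitials _
  rintro ⟨⟨A, a, ha, ha'⟩, X, e⟩
  -- Eliminating this equality replaces the underlying globular set of `C` by the truncation of `X`,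
  -- so the `eqToHom`s in morphisms out of `CX` become identities.
  change A = _ at e
  subst e
  let CX : CellExt T k hk := ⟨⟨_, a, ha, ha'⟩, X, rfl⟩
  change HasInitial (StructuredArrow CX (algToCellExt T k hk))
  let τ := trunc.{u} (Nat.cast_le.2 k.le_succ : (k : ℕ∞) ≤ ((k + 1 : ℕ) : ℕ∞))
  have hfst {D : GlobAlg T hk} (g : CX ⟶ (algToCellExt T k hk).obj D) :
      g.fst.f = τ.map g.snd :=
    (Category.comp_id _).symm.trans (g.eq.trans (Category.id_comp _))
  have hext {D : GlobAlg T hk} {g g' : CX ⟶ (algToCellExt T k hk).obj D}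
      (w : g.snd = g'.snd) : g = g' :=
    StrictPullback.Hom.ext (Monad.Algebra.Hom.ext (by rw [hfst, hfst, w])) w
  obtain ⟨Q, p, v, hp, hv, hQ⟩ := exists_generated_algebra (truncMonad T hk)
    (fun j : StructuredArrow CX (algToCellExt T k hk) => j.right) (fun j => j.hom.snd)
    (truncMonad_exists_rep T hk)
  -- Separation is a condition on globes, so it survives truncation; this makes the truncation of
  -- `p` a morphism of `k`-categories out of `C`.
  have hτ : JointlyInjective fun j => τ.map (v j).f := fun i h x y e => hv i _ x y e
  have hmon {Z : GlobSet.{u} k} (f g : Z ⟶ ((algTruncSucc T k hk).obj Q).A)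
      (e : ∀ j, f ≫ ((algTruncSucc T k hk).map (v j)).f =
        g ≫ ((algTruncSucc T k hk).map (v j)).f) : f = g := hτ.hom_ext e
  have hcomp (j : StructuredArrow CX (algToCellExt T k hk)) :
      (show CX.fst.A ⟶ ((algTruncSucc T k hk).obj Q).A from τ.map p) ≫
        ((algTruncSucc T k hk).map (v j)).f = j.hom.fst.f :=
    (τ.map_comp _ _).symm.trans ((congrArg τ.map (hp j)).trans (hfst j.hom).symm)
  let q₁ : CX.fst ⟶ (algTruncSucc T k hk).obj Q :=
    ⟨τ.map p, algebraHom_of_jointlyMonic _ _ _ hmon (fun j => j.hom.fst) hcomp⟩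
  let q : CX ⟶ (algToCellExt T k hk).obj Q :=
    ⟨q₁, p, (Category.comp_id _).trans (Category.id_comp _).symm⟩
  have hq (j : StructuredArrow CX (algToCellExt T k hk)) :
      q ≫ (algToCellExt T k hk).map (v j) = j.hom := hext (hp j)
  exact (IsInitial.ofUniqueHom (X := StructuredArrow.mk q)
    (fun j => StructuredArrow.homMk (v j) (hq j)) fun j g =>
    StructuredArrow.ext _ _ <| hQ _ _ _ <| congrArg StrictPullback.Hom.snd <|
      (StructuredArrow.w g).trans (hq j).symm).hasInitial

/-! ### Transfer of algebra structures along an invertible comparison. -/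

section Comparison

variable {A : Type*} [Category* A] {B : Type*} [Category* B] {S : Monad A} {M : Monad B}
  {τ : A ⥤ B} (l : τ ⋙ M.toFunctor ⟶ S.toFunctor ⋙ τ)

/-- The condition that `(A, a) ↦ (τ A, l ≫ τ a)` sends `S`-algebras to `M`-algebras. -/
structure LiftsAlgebras : Prop where
  unit (D : S.Algebra) : M.η.app (τ.obj D.A) ≫ l.app D.A ≫ τ.map D.a = 𝟙 (τ.obj D.A)
  assoc (D : S.Algebra) : M.μ.app (τ.obj D.A) ≫ l.app D.A ≫ τ.map D.a =
    M.map (l.app D.A ≫ τ.map D.a) ≫ l.app D.A ≫ τ.map D.a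

variable {l}

theorem comparison_map {X Y : A} (f : X ⟶ Y) :
    M.map (τ.map f) ≫ l.app Y = l.app X ≫ τ.map (S.map f) := l.naturality f

/-- Apply the unit law to the free algebra on `Y` and restrict along the image of `S.η.app Y`. With
`μ_app`, this recovers the laws of a morphism of monads from the mere fact that algebras are sent to
algebras. -/
theorem LiftsAlgebras.η_app (hl : LiftsAlgebras l) (Y : A) :
    M.η.app (τ.obj Y) ≫ l.app Y = τ.map (S.η.app Y) := by
  have h1 : M.η.app (τ.obj (S.obj Y)) ≫ l.app (S.obj Y) ≫ τ.map (S.μ.app Y) =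
    𝟙 (τ.obj (S.obj Y)) := hl.unit (S.free.obj Y)
  have h2 : τ.map (S.η.app Y) ≫ M.η.app (τ.obj (S.obj Y)) =
    M.η.app (τ.obj Y) ≫ M.map (τ.map (S.η.app Y)) := M.η.naturality (τ.map (S.η.app Y))
  have h3 : M.map (τ.map (S.η.app Y)) ≫ l.app (S.obj Y) =
    l.app Y ≫ τ.map (S.map (S.η.app Y)) := comparison_map _
  have h4 := τ.map_comp (S.map (S.η.app Y)) (S.μ.app Y)
  rw [S.right_unit] at h4
  have h5 := congrArg (τ.map (S.η.app Y) ≫ ·) h1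
  simp only [reassoc_of% h2, reassoc_of% h3, ← h4] at h5
  simpa using h5

theorem LiftsAlgebras.μ_app (hl : LiftsAlgebras l) (Y : A) :
    M.μ.app (τ.obj Y) ≫ l.app Y =
      M.map (l.app Y) ≫ l.app (S.obj Y) ≫ τ.map (S.μ.app Y) := by
  have h1 : M.μ.app (τ.obj (S.obj Y)) ≫ l.app (S.obj Y) ≫ τ.map (S.μ.app Y) =
    M.map (l.app (S.obj Y) ≫ τ.map (S.μ.app Y)) ≫ l.app (S.obj Y) ≫ τ.map (S.μ.app Y) :=
    hl.assoc (S.free.obj Y)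
  have h2 : M.map (M.map (τ.map (S.η.app Y))) ≫ M.μ.app (τ.obj (S.obj Y)) =
    M.μ.app (τ.obj Y) ≫ M.map (τ.map (S.η.app Y)) := M.μ.naturality (τ.map (S.η.app Y))
  have h3 : M.map (τ.map (S.η.app Y)) ≫ l.app (S.obj Y) ≫ τ.map (S.μ.app Y) = l.app Y := by
    have h4 := τ.map_comp (S.map (S.η.app Y)) (S.μ.app Y)
    have h5 : M.map (τ.map (S.η.app Y)) ≫ l.app (S.obj Y) =
      l.app Y ≫ τ.map (S.map (S.η.app Y)) := comparison_map _
    rw [S.right_unit] at h4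
    rw [reassoc_of% h5, ← h4]
    simp
  have h6 := congrArg (M.map (M.map (τ.map (S.η.app Y))) ≫ ·) h1
  simp only [reassoc_of% h2, ← M.map_comp_assoc, h3] at h6
  exact h6

variable [∀ Y, IsIso (l.app Y)] {c : M.Algebra} {R : A} {ε : τ.obj R ⟶ c.A}

/-- The structure of an algebra on an object `R` such that morphisms to `R` correspond to
morphisms to the underlying object of an algebra `c` by means of `ε : τ R ⟶ c.A`. -/
theorem LiftsAlgebras.exists_algebra (hl : LiftsAlgebras l)
    (hR : ∀ {Y : A} (g : τ.obj Y ⟶ c.A), ∃ f : Y ⟶ R, τ.map f ≫ ε = g)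
    (hR' : ∀ {Y : A} (f g : Y ⟶ R), τ.map f ≫ ε = τ.map g ≫ ε → f = g) :
    ∃ r : S.obj R ⟶ R, (l.app R ≫ τ.map r) ≫ ε = M.map ε ≫ c.a ∧
      S.η.app R ≫ r = 𝟙 R ∧ S.μ.app R ≫ r = S.map r ≫ r := by
  -- The structure map is the transpose of the action of `c`, carried across the inverse of `l`.
  obtain ⟨r, hr⟩ := hR (Y := S.obj R) (inv (l.app R) ≫ M.map ε ≫ c.a)
  have hr' : l.app R ≫ τ.map r ≫ ε = M.map ε ≫ c.a := by
    rw [hr]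
    exact IsIso.hom_inv_id_assoc (l.app R) _
  refine ⟨r, (Category.assoc _ _ _).trans hr', hR' _ _ ?_, hR' _ _ ?_⟩
  · rw [τ.map_comp, Category.assoc, ← hl.η_app, Category.assoc, hr', unit_map_algebra]
    simp
  -- After precomposition with these isomorphisms, `μ_app` reduces associativity of `r` to that of
  -- `c`.
  · have e : M.map (l.app R) ≫ l.app (S.obj R) ≫ τ.map (S.μ.app R ≫ r) ≫ ε =
        M.map (l.app R) ≫ l.app (S.obj R) ≫ τ.map (S.map r ≫ r) ≫ ε := by
      have h1 : M.map (τ.map r) ≫ l.app R = l.app (S.obj R) ≫ τ.map (S.map r) :=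
        comparison_map r
      have h2 := hl.μ_app R
      have h3 : M.map (M.map ε) ≫ M.μ.app c.A = M.μ.app (τ.obj R) ≫ M.map ε :=
        M.μ.naturality ε
      have h4 := c.assoc
      calc _ = (M.map (l.app R) ≫ l.app (S.obj R) ≫ τ.map (S.μ.app R)) ≫ τ.map r ≫ ε := by
            simp only [τ.map_comp, Category.assoc]
        _ = M.μ.app (τ.obj R) ≫ M.map ε ≫ c.a := by
            rw [← h2, Category.assoc, hr']
        _ = M.map (M.map ε ≫ c.a) ≫ c.a := by
            rw [← reassoc_of% h3, h4, M.map_comp, Category.assoc]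
        _ = M.map (l.app R) ≫ M.map (τ.map r) ≫ M.map ε ≫ c.a := by
            rw [← hr']
            simp only [M.map_comp, Category.assoc]
            rw [hr']
        _ = _ := by
            rw [τ.map_comp, Category.assoc, ← reassoc_of% h1, hr']
    exact (cancel_epi (l.app (S.obj R))).1 ((cancel_epi (M.map (l.app R))).1 e)

/-- Here `hf` says that the transpose of `f` is a morphism of `M`-algebras; transposing the desired
equation and cancelling `l` gives exactly this. -/
theorem algebraHom_of_comparison
    (hR' : ∀ {Y : A} (f g : Y ⟶ R), τ.map f ≫ ε = τ.map g ≫ ε → f = g) {r : S.obj R ⟶ R}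
    (hr : (l.app R ≫ τ.map r) ≫ ε = M.map ε ≫ c.a) (E : S.Algebra) (f : E.A ⟶ R)
    (hf : M.map (τ.map f ≫ ε) ≫ c.a = (l.app E.A ≫ τ.map E.a) ≫ τ.map f ≫ ε) :
    S.map f ≫ r = E.a ≫ f := by
  refine hR' _ _ ((cancel_epi (l.app E.A)).1 ?_)
  have h1 : M.map (τ.map f) ≫ l.app R = l.app E.A ≫ τ.map (S.map f) := comparison_map f
  calc _ = (l.app E.A ≫ τ.map (S.map f)) ≫ τ.map r ≫ ε := by
        simp only [τ.map_comp, Category.assoc]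
    _ = M.map (τ.map f ≫ ε) ≫ c.a := by
        rw [← h1, Category.assoc, M.map_comp, Category.assoc, ← hr, Category.assoc]
    _ = _ := by
        rw [hf, τ.map_comp]
        simp only [Category.assoc]

end Comparison

/-! ### Truncability makes the comparison of truncated monads invertible. -/

section TruncComparison

variable {n : ℕ∞} (T : Monad (GlobSet.{u} n))

/-- For `k ≤ l ≤ n`, the canonical morphism from `Tᵏ` of a `k`-truncation to the `k`-truncation
of `Tˡ`. -/
def truncComparison {k l : ℕ∞} (hkl : k ≤ l) (hln : l ≤ n) :
    trunc.{u} hkl ⋙ (truncMonad T (hkl.trans hln)).toFunctor ⟶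
      (truncMonad T hln).toFunctor ⋙ trunc.{u} hkl where
  app Y := (trunc hkl).map ((trunc hln).map (T.map ((inclTruncHom hkl hln).app Y)))
  naturality _ _ f := (Functor.whiskerRight
    (inclTruncHom hkl hln) (T.toFunctor ⋙ trunc hln ⋙ trunc hkl)).naturality f

theorem algTrunc_obj_a {k l : ℕ∞} (hkl : k ≤ l) (hln : l ≤ n) (D : GlobAlg T hln) :
    ((algTrunc T hkl hln).obj D).a =
      (truncComparison T hkl hln).app D.A ≫ (trunc hkl).map D.a :=
  (trunc hkl).map_comp _ _

theorem truncComparison_liftsAlgebras {k l : ℕ∞} (hkl : k ≤ l) (hln : l ≤ n) :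
    LiftsAlgebras (truncComparison T hkl hln) where
  unit D := by
    rw [← algTrunc_obj_a]
    exact ((algTrunc T hkl hln).obj D).unit
  assoc D := by
    rw [← algTrunc_obj_a]
    exact ((algTrunc T hkl hln).obj D).assoc

/-- Brings in the counit of the adjunction, which is what truncability speaks about. -/
theorem inclTruncHom_app_eq {k l : ℕ∞} (hkl : k ≤ l) (hln : l ≤ n) (Y : GlobSet.{u} l) :
    (inclTruncHom hkl hln).app Y =
      (incl (hkl.trans hln)).map ((trunc hkl).map ((inclTruncAdj hln).unit.app Y)) ≫
        (inclTruncAdj (hkl.trans hln)).counit.app ((incl hln).obj Y) := by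
  rw [← inclTruncHom_counit hkl hln]
  have h := (inclTruncHom hkl hln).naturality_assoc ((inclTruncAdj hln).unit.app Y)
    ((inclTruncAdj hln).counit.app ((incl hln).obj Y))
  exact (Category.comp_id _).symm.trans ((congrArg ((inclTruncHom hkl hln).app Y ≫ ·)
    ((inclTruncAdj hln).left_triangle_components Y).symm).trans h.symm)

theorem inclTruncAdj_unit_isIso {k m : ℕ∞} (hkm : k ≤ m) (Y : GlobSet.{u} k) :
    IsIso ((inclTruncAdj hkm).unit.app Y) :=
  ⟨⟨fun i h => inclEquiv Y h, fun i h x => by simp [trunc, incl], fun i h x => by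
    simp [trunc, incl]⟩,
    GlobSet.hom_ext fun i h x => Equiv.apply_symm_apply (inclEquiv Y h) x,
    GlobSet.hom_ext fun i h x => Equiv.symm_apply_apply (inclEquiv Y h) x⟩

-- Up to the invertible unit of inclusion ⊣ truncation, the comparison at `Y` is the component of
-- `monTrunc` at the inclusion of `Y`, which is an `eqToHom`.
variable {T} in
theorem IsTruncable.truncComparison_isIso (hT : IsTruncable T) {k : ℕ} {l : ℕ∞}
    (hkl : (k : ℕ∞) ≤ l) (hln : l ≤ n) (hkn : (k : ℕ∞) < n) (Y : GlobSet.{u} l) :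
    IsIso ((truncComparison T hkl hln).app Y) := by
  obtain ⟨e, he⟩ := hT k hkn
  have h1 : IsIso ((monTrunc T hkn.le).app ((incl hln).obj Y)) := by
    rw [he]
    infer_instance
  have h2 := inclTruncAdj_unit_isIso hln Y
  let G := T.toFunctor ⋙ trunc hln ⋙ trunc hkl
  have h3 : (truncComparison T hkl hln).app Y = G.map ((inclTruncHom hkl hln).app Y) := rfl
  rw [h3, inclTruncHom_app_eq]
  have h4 : IsIso (G.map ((inclTruncAdj (hkl.trans hln)).counit.app ((incl hln).obj Y))) := h1
  have h5 : IsIso (G.map ((incl (hkl.trans hln)).map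
    ((trunc hkl).map ((inclTruncAdj hln).unit.app Y)))) := inferInstance
  exact (congrArg (fun f => IsIso f) (G.map_comp _ _)).mpr (IsIso.comp_isIso' h5 h4)

end TruncComparison

/-! ### The coskeleton of a globular set. -/

namespace GlobSet

/-- Two globes of the same dimension are parallel when they have the same source and target. -/
def Parallel {m : ℕ∞} (B : GlobSet.{u} m) :
    ∀ (i : ℕ) (h : (i : ℕ∞) ≤ m), B.cells i h → B.cells i h → Prop
  | 0, _, _, _ => True
  | i + 1, h, x, y => B.src i h x = B.src i h y ∧ B.tgt i h x = B.tgt i h y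

theorem parallel_src_tgt {m : ℕ∞} (Y : GlobSet.{u} m) (i : ℕ) (h : ((i + 1 : ℕ) : ℕ∞) ≤ m)
    (x : Y.cells (i + 1) h) : Y.Parallel i _ (Y.src i h x) (Y.tgt i h x) := by
  cases i with
  | zero => trivial
  | succ i => exact ⟨Y.src_src i h x, Y.tgt_src i h x⟩

theorem Parallel.map {m : ℕ∞} {Y Z : GlobSet.{u} m} (f : Y ⟶ Z) {i : ℕ} {h : (i : ℕ∞) ≤ m}
    {x y : Y.cells i h} (hxy : Y.Parallel i h x y) :
    Z.Parallel i h (f.app i h x) (f.app i h y) := by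
  cases i with
  | zero => trivial
  | succ i =>
    obtain ⟨h1, h2⟩ := hxy
    refine ⟨?_, ?_⟩
    · rw [f.src_app, f.src_app, h1]
    · rw [f.tgt_app, f.tgt_app, h2]

variable {k : ℕ}

/-- The globes of the coskeleton of a `k`-globular set `B`: those of `B` and, in dimension `k + 1`,
the pairs of parallel `k`-globes of `B`. -/
inductive CoskCells (B : GlobSet.{u} k) : ℕ → Type u
  | low (i : ℕ) (h : (i : ℕ∞) ≤ k) (x : B.cells i h) : CoskCells B i
  | top (x y : B.cells k le_rfl) (h : B.Parallel k le_rfl x y) : CoskCells B (k + 1)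

namespace CoskCells

variable {B : GlobSet.{u} k}

/-- The source of a globe of the coskeleton. -/
def src : ∀ {i : ℕ}, CoskCells B (i + 1) → CoskCells B i
  | i, low _ h x => low i _ (B.src i h x)
  | _, top x _ _ => low k le_rfl x

/-- The target of a globe of the coskeleton. -/
def tgt : ∀ {i : ℕ}, CoskCells B (i + 1) → CoskCells B i
  | i, low _ h x => low i _ (B.tgt i h x)
  | _, top _ y _ => low k le_rfl y

/-- The globe of `B` given by a globe of dimension at most `k` of the coskeleton of `B`. -/
def val : ∀ {i : ℕ}, CoskCells B i → ∀ h : (i : ℕ∞) ≤ k, B.cells i h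
  | _, low _ _ x, _ => x
  | _, top _ _ _, h => absurd (Nat.cast_le.1 h) k.lt_irrefl

theorem low_val {i : ℕ} (x : CoskCells B i) (h : (i : ℕ∞) ≤ k) : low i h (x.val h) = x := by
  cases x with
  | low => rfl
  | top => exact absurd (Nat.cast_le.1 h) k.lt_irrefl

theorem val_src {i : ℕ} (x : CoskCells B (i + 1)) (h : ((i + 1 : ℕ) : ℕ∞) ≤ k) :
    B.src i h (x.val h) = x.src.val ((Nat.cast_le.2 i.le_succ).trans h) := by
  cases x with
  | low => rfl
  | top => exact absurd (Nat.cast_le.1 h) k.lt_irrefl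

theorem val_tgt {i : ℕ} (x : CoskCells B (i + 1)) (h : ((i + 1 : ℕ) : ℕ∞) ≤ k) :
    B.tgt i h (x.val h) = x.tgt.val ((Nat.cast_le.2 i.le_succ).trans h) := by
  cases x with
  | low => rfl
  | top => exact absurd (Nat.cast_le.1 h) k.lt_irrefl

theorem src_src {i : ℕ} (x : CoskCells B (i + 1 + 1)) : x.src.src = x.tgt.src := by
  cases x with
  | low _ h x => exact congrArg (low i _) (B.src_src i h x)
  | top x y h => exact congrArg (low i _) h.1

theorem tgt_src {i : ℕ} (x : CoskCells B (i + 1 + 1)) : x.src.tgt = x.tgt.tgt := by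
  cases x with
  | low _ h x => exact congrArg (low i _) (B.tgt_src i h x)
  | top x y h => exact congrArg (low i _) h.2

theorem ext_top {x y : CoskCells B (k + 1)} (hs : x.src = y.src) (ht : x.tgt = y.tgt) :
    x = y := by
  cases x with
  | low _ h => exact absurd (Nat.cast_le.1 h) k.lt_irrefl
  | top x x' =>
    cases y with
    | low _ h => exact absurd (Nat.cast_le.1 h) k.lt_irrefl
    | top y y' =>
      obtain rfl : x = y := congrArg (fun z => z.val le_rfl) hs
      obtain rfl : x' = y' := congrArg (fun z => z.val le_rfl) ht
      rfl

end CoskCells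

/-- The coskeleton of a `k`-globular set, with one `(k + 1)`-globe between parallel `k`-globes. -/
def cosk (B : GlobSet.{u} k) : GlobSet.{u} ((k + 1 : ℕ) : ℕ∞) where
  cells i _ := CoskCells B i
  src _ _ := CoskCells.src
  tgt _ _ := CoskCells.tgt
  src_src _ _ := CoskCells.src_src
  tgt_src _ _ := CoskCells.tgt_src

/-- The truncation of `(k + 1)`-globular sets to `k`-globular sets. -/
abbrev truncSucc (k : ℕ) : GlobSet.{u} ((k + 1 : ℕ) : ℕ∞) ⥤ GlobSet.{u} (k : ℕ∞) :=
  trunc (Nat.cast_le.2 k.le_succ)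

/-- The identification of the truncation of the coskeleton of `B` with `B`. -/
def coskTruncIso (B : GlobSet.{u} k) : (truncSucc k).obj B.cosk ≅ B where
  hom :=
    { app := fun _ h x => CoskCells.val x h
      src_app := fun _ h x => CoskCells.val_src x h
      tgt_app := fun _ h x => CoskCells.val_tgt x h }
  inv :=
    { app := fun i h x => .low i h x
      src_app := fun _ _ _ => rfl
      tgt_app := fun _ _ _ => rfl }
  hom_inv_id := GlobSet.hom_ext fun _ h x => CoskCells.low_val x h
  inv_hom_id := rfl

/-- A `(k+1)`-globe of the coskeleton is determined by its boundary. Together with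
`exists_cosk_lift`, this is the universal property of a right adjoint to truncation. -/
theorem cosk_hom_ext {B : GlobSet.{u} k} {Y : GlobSet.{u} ((k + 1 : ℕ) : ℕ∞)} (f g : Y ⟶ B.cosk)
    (e : (truncSucc k).map f ≫ B.coskTruncIso.hom = (truncSucc k).map g ≫ B.coskTruncIso.hom) :
    f = g := by
  have e' := (cancel_mono _).1 e
  have low (i : ℕ) (h : (i : ℕ∞) ≤ k) (h' : (i : ℕ∞) ≤ ((k + 1 : ℕ) : ℕ∞)) (x : Y.cells i h') :
      f.app i h' x = g.app i h' x :=
    congrArg (fun t : (truncSucc k).obj Y ⟶ (truncSucc k).obj B.cosk => Hom.app t i h x) e'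
  refine GlobSet.hom_ext fun i h x => ?_
  obtain hi | rfl := (Nat.cast_le.1 h).lt_or_eq
  · exact low i (Nat.cast_le.2 (Nat.le_of_lt_succ hi)) h x
  · refine CoskCells.ext_top ?_ ?_
    · exact (f.src_app k h x).trans ((low k le_rfl _ _).trans (g.src_app k h x).symm)
    · exact (f.tgt_app k h x).trans ((low k le_rfl _ _).trans (g.tgt_app k h x).symm)

theorem parallel_app_src_tgt {B : GlobSet.{u} k} {Y : GlobSet.{u} ((k + 1 : ℕ) : ℕ∞)}
    (g : (truncSucc k).obj Y ⟶ B) (h : ((k + 1 : ℕ) : ℕ∞) ≤ ((k + 1 : ℕ) : ℕ∞))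
    (x : Y.cells (k + 1) h) :
    B.Parallel k le_rfl (g.app k le_rfl (Y.src k h x)) (g.app k le_rfl (Y.tgt k h x)) := by
  refine Parallel.map g ?_
  cases k with
  | zero => trivial
  | succ k => exact Y.parallel_src_tgt _ h x

/-- The image of a globe of `Y` by the morphism to the coskeleton of `B` given by a morphism to `B`
from the truncation of `Y`. -/
def coskLiftApp {B : GlobSet.{u} k} {Y : GlobSet.{u} ((k + 1 : ℕ) : ℕ∞)}
    (g : (truncSucc k).obj Y ⟶ B) (i : ℕ) (h : (i : ℕ∞) ≤ ((k + 1 : ℕ) : ℕ∞))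
    (x : Y.cells i h) : CoskCells B i :=
  if hi : (i : ℕ∞) ≤ k then .low i hi (g.app i hi x)
  else
    match i, (Nat.cast_le.1 h).antisymm (Nat.lt_of_not_le fun h' => hi (Nat.cast_le.2 h')), h, x with
    | _, rfl, h, x => .top (g.app k le_rfl (Y.src k h x)) (g.app k le_rfl (Y.tgt k h x))
        (parallel_app_src_tgt g h x)

/-- A `(k+1)`-globe goes to the pair of images of its source and target, which is parallel by the
globular identities. -/
theorem exists_cosk_lift {B : GlobSet.{u} k} {Y : GlobSet.{u} ((k + 1 : ℕ) : ℕ∞)}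
    (g : (truncSucc k).obj Y ⟶ B) :
    ∃ f : Y ⟶ B.cosk, (truncSucc k).map f ≫ B.coskTruncIso.hom = g := by
  have low (i : ℕ) (hi : (i : ℕ∞) ≤ k) (h : (i : ℕ∞) ≤ ((k + 1 : ℕ) : ℕ∞)) (x : Y.cells i h) :
      coskLiftApp g i h x = .low i hi (g.app i hi x) := dif_pos hi
  have top (h : ((k + 1 : ℕ) : ℕ∞) ≤ ((k + 1 : ℕ) : ℕ∞)) (x : Y.cells (k + 1) h) :
      coskLiftApp g (k + 1) h x =
        .top (g.app k le_rfl (Y.src k h x)) (g.app k le_rfl (Y.tgt k h x))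
          (parallel_app_src_tgt g h x) := by
    rw [coskLiftApp, dif_neg fun h => absurd (Nat.cast_le.1 h) k.lt_irrefl]
  refine ⟨⟨coskLiftApp g, fun i h x => ?_, fun i h x => ?_⟩, GlobSet.hom_ext fun i h x =>
    congrArg (fun z => CoskCells.val z h) (low i h (h.trans (Nat.cast_le.2 k.le_succ)) x)⟩
  · obtain hi | hi := (Nat.cast_le.1 h).lt_or_eq
    · rw [low _ (Nat.cast_le.2 (Nat.le_of_lt_succ hi)),
        low _ (Nat.cast_le.2 (i.le_succ.trans (Nat.le_of_lt_succ hi)))]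
      exact congrArg (CoskCells.low i _) (g.src_app i _ x)
    · obtain rfl := Nat.succ.inj hi
      rw [top, low _ le_rfl]
      rfl
  · obtain hi | hi := (Nat.cast_le.1 h).lt_or_eq
    · rw [low _ (Nat.cast_le.2 (Nat.le_of_lt_succ hi)),
        low _ (Nat.cast_le.2 (i.le_succ.trans (Nat.le_of_lt_succ hi)))]
      exact congrArg (CoskCells.low i _) (g.tgt_app i _ x)
    · obtain rfl := Nat.succ.inj hi
      rw [top, low _ le_rfl]
      rfl

end GlobSet

/-! ### Coskeletal algebras and invertibility of the unit. -/

theorem cellExt_hom_snd {n : ℕ∞} {T : Monad (GlobSet.{u} n)} {k : ℕ}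
    {hk : ((k + 1 : ℕ) : ℕ∞) ≤ n} {CX : CellExt T k hk} {R : GlobAlg T hk}
    (f : CX ⟶ (algToCellExt T k hk).obj R) :
    (truncSucc k).map f.snd = eqToHom CX.eq.symm ≫ f.fst.f := by
  have h : f.fst.f ≫ 𝟙 _ = eqToHom CX.eq ≫ (truncSucc k).map f.snd := f.eq
  exact (eqToHom_comp_iff CX.eq _ _).1 (h.symm.trans (Category.comp_id _))

/-- The coskeleton of a `k`-category is a `(k + 1)`-category when the monad is truncable; it is
right adjoint to truncation, and morphisms of cellular extensions to it are also determined by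
morphisms of `k`-categories. -/
theorem IsTruncable.exists_cosk_algebra {n : ℕ∞} {T : Monad (GlobSet.{u} n)} (hT : IsTruncable T)
    (k : ℕ) (hk : ((k + 1 : ℕ) : ℕ∞) ≤ n)
    (D : GlobAlg T ((Nat.cast_le.2 k.le_succ : (k : ℕ∞) ≤ _).trans hk)) :
    ∃ (R : GlobAlg T hk) (ε : (algTruncSucc T k hk).obj R ⟶ D),
      (∀ (E : GlobAlg T hk) (g : (algTruncSucc T k hk).obj E ⟶ D),
        ∃ f : E ⟶ R, (algTruncSucc T k hk).map f ≫ ε = g) ∧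
      (∀ (CX : CellExt T k hk) (g : CX.fst ⟶ D),
        ∃ f : CX ⟶ (algToCellExt T k hk).obj R, f.fst ≫ ε = g) ∧
      ∀ (CX : CellExt T k hk) (f f' : CX ⟶ (algToCellExt T k hk).obj R),
        f.fst ≫ ε = f'.fst ≫ ε → f = f' := by
  have hkk : (k : ℕ∞) ≤ ((k + 1 : ℕ) : ℕ∞) := Nat.cast_le.2 k.le_succ
  have hkn : (k : ℕ∞) < n := lt_of_lt_of_le (Nat.cast_lt.2 k.lt_succ_self) hk
  have hiso := hT.truncComparison_isIso hkk hk hkn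
  obtain ⟨r, hr, hunit, hassoc⟩ := (truncComparison_liftsAlgebras T hkk hk).exists_algebra
    (c := D) (R := D.A.cosk) (ε := D.A.coskTruncIso.hom) exists_cosk_lift cosk_hom_ext
  let R : GlobAlg T hk := ⟨D.A.cosk, r, hunit, hassoc⟩
  let ε : (algTruncSucc T k hk).obj R ⟶ D :=
    ⟨D.A.coskTruncIso.hom, by
      rw [algTrunc_obj_a]
      exact hr.symm⟩
  have hε : IsIso ε := by
    have : IsIso ((Monad.forget _).map ε) := D.A.coskTruncIso.isIso_hom
    exact isIso_of_reflects_iso ε (Monad.forget _)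
  refine ⟨R, ε, fun E g => ?_, fun CX g => ?_, fun CX f f' e => ?_⟩
  · obtain ⟨f, hf⟩ := exists_cosk_lift (Y := E.A) g.f
    refine ⟨⟨f, algebraHom_of_comparison cosk_hom_ext hr E f ?_⟩, Monad.Algebra.Hom.ext hf⟩
    have hg := g.h
    rw [algTrunc_obj_a] at hg
    rw [hf]
    exact hg
  -- The globular component is the transpose of `g`; the algebra component must be `g` followed by
  -- the inverse `δ` of `ε`. They agree on `k`-truncations after cancelling `ε`.
  · obtain ⟨f, hf⟩ := exists_cosk_lift (Y := CX.snd) (eqToHom CX.eq.symm ≫ g.f)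
    obtain ⟨δ, -, hδ⟩ := hε
    refine ⟨⟨g ≫ δ, f, ?_⟩, (Category.assoc _ _ _).trans
      ((congrArg (g ≫ ·) hδ).trans (Category.comp_id g))⟩
    have h1 : (truncSucc k).map f ≫ ε.f = eqToHom CX.eq.symm ≫ g.f := hf
    have h2 : δ.f ≫ ε.f = 𝟙 D.A := congrArg Monad.Algebra.Hom.f hδ
    have : Mono ε.f := inferInstanceAs (Mono D.A.coskTruncIso.hom)
    refine (Category.comp_id _).trans ((cancel_mono ε.f).1 ?_)
    refine (Category.assoc _ _ _).trans ?_
    refine ((congrArg (g.f ≫ ·) h2).trans (Category.comp_id _)).trans ?_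
    refine Eq.trans ?_ ((congrArg (eqToHom CX.eq ≫ ·) h1.symm).trans (Category.assoc _ _ _).symm)
    exact (eqToHom_comp_iff CX.eq.symm _ _).1 rfl
  · have h1 : f.fst = f'.fst := (cancel_mono ε).1 e
    refine StrictPullback.Hom.ext h1 (cosk_hom_ext _ _ (congrArg (· ≫ _) ?_))
    exact (cellExt_hom_snd f).trans
      ((congrArg (fun t => eqToHom CX.eq.symm ≫ Monad.Algebra.Hom.f t) h1).trans
        (cellExt_hom_snd f').symm)

theorem IsTruncable.unit_fst_isIso {n : ℕ∞} {T : Monad (GlobSet.{u} n)} (hT : IsTruncable T)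
    {k : ℕ} {hk : ((k + 1 : ℕ) : ℕ∞) ≤ n} {free : CellExt T k hk ⥤ GlobAlg T hk}
    (adj : free ⊣ algToCellExt T k hk) (CX : CellExt T k hk) :
    IsIso ((cellExtAlg T k hk).map (adj.unit.app CX)) := by
  -- Transposition along `adj`, read on `k`-categories, is precomposition with the component of the
  -- unit.
  have hfac {R : GlobAlg T hk} (f : free.obj CX ⟶ R) {D} (ε : (algTruncSucc T k hk).obj R ⟶ D) :
      (adj.homEquiv CX R f).fst ≫ ε =
        (cellExtAlg T k hk).map (adj.unit.app CX) ≫ (algTruncSucc T k hk).map f ≫ ε :=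
    (congrArg (fun t => StrictPullback.Hom.fst t ≫ ε) (adj.homEquiv_unit ..)).trans
      (Category.assoc _ _ _)
  refine isIso_of_coyoneda_map_bijective _ fun D => ?_
  obtain ⟨R, ε, h1, h2, h3⟩ := hT.exists_cosk_algebra k hk D
  refine ⟨fun g g' e => ?_, fun g => ?_⟩
  -- Both morphisms out of `C[X]_{≤k}` extend to `C[X] ⟶ R`; their transposes agree as soon as they
  -- agree on `C`.
  · obtain ⟨f, rfl⟩ := h1 _ g
    obtain ⟨f', rfl⟩ := h1 _ g'
    have : f = f' := (adj.homEquiv CX R).injective <| h3 _ _ _ <|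
      (hfac f ε).trans (e.trans (hfac f' ε).symm)
    rw [this]
  · obtain ⟨f, rfl⟩ := h2 CX g
    obtain ⟨f, rfl⟩ := (adj.homEquiv CX R).surjective f
    exact ⟨(algTruncSucc T k hk).map f ≫ ε, (hfac f ε).symm⟩

theorem mainTheorem6 {n : ℕ∞} (T : Monad (GlobSet.{u} n))
    [PreservesFilteredColimits T.toFunctor] (hT : IsTruncable T)
    (k : ℕ) (hk : ((k + 1 : ℕ) : ℕ∞) ≤ n) :
    (algToCellExt T k hk).IsRightAdjoint ∧
      ∀ (free : CellExt T k hk ⥤ GlobAlg T hk) (adj : free ⊣ algToCellExt T k hk),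
        ∃ e : cellExtAlg T k hk ≅ free ⋙ algTruncSucc T k hk,
          ∀ CX : CellExt T k hk, e.hom.app CX = (cellExtAlg T k hk).map (adj.unit.app CX) := by
  refine ⟨algToCellExt_isRightAdjoint T k hk, fun free adj => ?_⟩
  let α : cellExtAlg T k hk ⟶ free ⋙ algTruncSucc T k hk :=
    { app := fun CX => (cellExtAlg T k hk).map (adj.unit.app CX)
      naturality := (Functor.whiskerRight adj.unit (cellExtAlg T k hk)).naturality }
  have (CX : CellExt T k hk) : IsIso (α.app CX) := hT.unit_fst_isIso adj CX
  have : IsIso α := NatIso.isIso_of_isIso_app α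
  exact ⟨asIso α, fun _ => rfl⟩
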